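/- Let $\Gamma$ be a group, $A$ an abelian group (written additively), and let $\alpha:\Gamma^3\to A$ be a strongly normalized $3$-cocycle, i.e. $$\alpha(x,y,z)-\alpha(xy,z,w)+\alpha(x,yz,w)-\alpha(x,y,zw)+\alpha(y,z,w)=0\quad\text{for all }x,y,z,w\in\Gamma,$$ and $\alpha(x,y,z)=0$ whenever $1\in\{x,y,z,xy,yz\}$. Fix $z\in\Gamma$. *The function $\epsilon$.* There is a function $f_z:\mathbb{Z}^2\to A$ with $\alpha(z^a,z^b,z^c)=f_z(b,c)-f_z(a+b,c)+f_z(a,b+c)-f_z(a,b)$ for all $a,b,c\in\mathbb{Z}$, and $\epsilon(z;a,b):=f_z(a,b)-f_z(b,a)$ does not depend on the choice of $f_z$. *Chains on the torus.* Let $\pi:\mathbb{R}^2\to\mathbb{T}^2=S^1\times S^1$ be the universal covering, where $S^1=\mathbb{R}/\mathbb{Z}$, with base point $\ast=\pi(0)$. For $A_0,A_1,A_2\in\mathbb{Z}^2$ let $[A_0A_1A_2]$ be the singular $2$-simplex of $\mathbb{T}^2$ obtained by composing $\pi$ with the affine map $\Delta^2\to\mathbb{R}^2$, $v_i\mapsto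 A_i$. Put $$\xi^{\rm st}_{\mathbb{T}^2}=[OW_1W_3]-[OW_2W_3]\in C_2(\mathbb{T}^2;\mathbb{Z}),\qquad O=(0,0),\ W_1=(1,0),\ W_2=(0,1),\ W_3=(1,1).$$ For $\mathbf{a}\in{\rm SL}(2,\mathbb{Z})$ let $\hat{\mathbf{a}}:\mathbb{T}^2\to\mathbb{T}^2$ be the map induced by left multiplication by $\mathbf{a}$ on column vectors in $\mathbb{R}^2$. *Cycle-cocycle values.* For a functor $\phi$ from the fundamental groupoid $\Pi_1(\mathbb{T}^2)$ to $\Gamma$ (a groupoid with one object, with $\phi(pq)=\phi(p)\phi(q)$ for the path $p$ followed by $q$) and a singular $3$-chain $\zeta=\sum_i n_i\sigma^i$, put $\alpha(\zeta\langle\phi\rangle)=\sum_i n_i\,\alpha\big(\phi(\sigma^i_{01}),\phi(\sigma^i_{12}),\phi(\sigma^i_{23})\big)$, where $\sigma_{jk}$ is the restriction of $\sigma$ to the edge $[v_j,v_k]$. For $\xi,\xi'\in C_2(\mathbb{T}^2;\mathbb{Z})$ put $\alpha^\phi(\xi;\xi')=\alpha(\zeta\langle\phi\rangle)$, where $\zeta$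 is any singular $3$-chain with $\partial\zeta=\xi-\xi'$. **Lemma.** There is a unique functor $\phi_z$ to $\Gamma$ from the full subgroupoid of $\Pi_1(\mathbb{T}^2)$ on the object $\ast$ that sends the meridian loop $S^1\times 1$ to $1$ and the longitude loop $1\times S^1$ to $z$; it is the restriction of some functor on all of $\Pi_1(\mathbb{T}^2)$. Let $\mathbf{a}=\begin{pmatrix}a&b\\c&d\end{pmatrix}\in{\rm SL}(2,\mathbb{Z})$. Then $\hat{\mathbf{a}}_\#\xi^{\rm st}_{\mathbb{T}^2}-\xi^{\rm st}_{\mathbb{T}^2}$ is the boundary of a singular $3$-chain, and for every functor $\phi:\Pi_1(\mathbb{T}^2)\to\Gamma$ restricting to $\phi_z$ the value $\alpha^{\phi}\big(\hat{\mathbf{a}}_\#\xi^{\rm st}_{\mathbb{T}^2};\xi^{\rm st}_{\mathbb{T}^2}\big)$ does not depend on the $3$-chain used to compute it, and $$\alpha^{\phi}\big(\hat{\mathbf{a}}_\#\xi^{\rm st}_{\mathbb{T}^2};\xi^{\rm st}_{\mathbb{T}^2}\big)=\epsilon(z;c,d).$$ In particular, the value depends only on the bottom row of $\mathbf{a}$.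 -/

import Mathlib

open CategoryTheory

noncomputable section

namespace CycleCocycle

/-! ### Singular chains -/

/-- Singular `k`-simplices of `X`: continuous maps from the standard `k`-simplex to `X`. -/
abbrev Simplex (X : Type*) [TopologicalSpace X] (k : ℕ) : Type _ :=
  C(stdSimplex ℝ (Fin (k + 1)), X)

/-- The group `C_k(X)` of integral singular `k`-chains. -/
abbrev Chain (X : Type*) [TopologicalSpace X] (k : ℕ) : Type _ := Simplex X k →₀ ℤ

/-- The affine map `Δ^k → Δ^{k+1}` onto the face opposite to the vertex `i`. -/
def face (k : ℕ) (i : Fin (k + 2)) :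
    C(stdSimplex ℝ (Fin (k + 1)), stdSimplex ℝ (Fin (k + 2))) :=
  ⟨stdSimplex.map i.succAbove, stdSimplex.continuous_map _⟩

/-- The singular boundary `∂ σ = ∑ᵢ (-1)ⁱ σ ∘ dᵢ`. -/
def boundary (X : Type*) [TopologicalSpace X] (k : ℕ) : Chain X (k + 1) →+ Chain X k :=
  Finsupp.liftAddHom fun σ : Simplex X (k + 1) =>
    zmultiplesHom (Chain X k)
      (∑ i : Fin (k + 2), (-1 : ℤ) ^ (i : ℕ) • Finsupp.single (σ.comp (face k i)) (1 : ℤ))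

/-- The chain map `g_#` induced by a continuous map `g`. -/
def pushforward {X Y : Type*} [TopologicalSpace X] [TopologicalSpace Y] (g : C(X, Y)) (k : ℕ) :
    Chain X k →+ Chain Y k :=
  Finsupp.mapDomain.addMonoidHom fun σ : Simplex X k => g.comp σ

/-- The straight path `t ↦ (1 - t) vᵢ + t vⱼ` in the standard simplex. -/
def edge (k : ℕ) (i j : Fin (k + 1)) :
    Path (stdSimplex.vertex (S := ℝ) i) (stdSimplex.vertex (S := ℝ) j) where
  toFun t := ⟨(1 - (t : ℝ)) • Pi.single i (1 : ℝ) + (t : ℝ) • Pi.single j (1 : ℝ),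
    (convex_stdSimplex ℝ (Fin (k + 1))) (single_mem_stdSimplex ℝ i) (single_mem_stdSimplex ℝ j)
      (by linarith [t.2.2]) t.2.1 (by ring)⟩
  continuous_toFun := by fun_prop
  source' := by ext; simp
  target' := by ext; simp

/-- The path `σ_{ij}`, from `σ(vᵢ)` to `σ(vⱼ)`. -/
def edgePath {X : Type*} [TopologicalSpace X] {k : ℕ} (σ : Simplex X k) (i j : Fin (k + 1)) :
    Path (σ (stdSimplex.vertex i)) (σ (stdSimplex.vertex j)) :=
  (edge k i j).map σ.continuous

/-! ### Functors from the fundamental groupoid to a group -/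

/-- The set `𝔅(X)` of functors `Π₁(X) → Γ`. In Mathlib the composition of `SingleObj M` is
`f ≫ g = g * f`, so the opposite group makes the value on a concatenation "`p`, then `q`" equal
to the product (value on `p`) * (value on `q`) in `Γ`. -/
abbrev Rep (X : Type*) [TopologicalSpace X] (Γ : Type*) [Group Γ] : Type _ :=
  FundamentalGroupoid X ⥤ SingleObj Γᵐᵒᵖ

/-- The value `φ(p) ∈ Γ` on (the homotopy class of) a path `p`. -/
def Rep.val {X : Type*} [TopologicalSpace X] {Γ : Type*} [Group Γ] (φ : Rep X Γ) {x y : X}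
    (p : Path x y) : Γ :=
  MulOpposite.unop (φ.map (FundamentalGroupoid.fromPath (Path.Homotopic.Quotient.mk p)) : Γᵐᵒᵖ)

theorem Rep.val_trans {X : Type*} [TopologicalSpace X] {Γ : Type*} [Group Γ] (φ : Rep X Γ)
    {x y w : X} (p : Path x y) (q : Path y w) : φ.val (p.trans q) = φ.val p * φ.val q :=
  congrArg MulOpposite.unop
    (φ.map_comp (FundamentalGroupoid.fromPath (Path.Homotopic.Quotient.mk p))
      (FundamentalGroupoid.fromPath (Path.Homotopic.Quotient.mk q)))

/-- The objects of `Π₁(X)` lying in a given set `V` of vertices. -/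
def inVertices {X : Type*} [TopologicalSpace X] (V : Set X) :
    ObjectProperty (FundamentalGroupoid X) :=
  fun x => x.as ∈ V

/-- The set `𝔅⁰(X)` of functors to `Γ` from the full subgroupoid of `Π₁(X)` on the vertices
in `V`. -/
abbrev Rep0 (X : Type*) [TopologicalSpace X] (V : Set X) (Γ : Type*) [Group Γ] : Type _ :=
  (inVertices V).FullSubcategory ⥤ SingleObj Γᵐᵒᵖ

/-- The value of `φ ∈ 𝔅⁰(X)` on a path between two vertices. -/
def Rep0.val {X : Type*} [TopologicalSpace X] {V : Set X} {Γ : Type*} [Group Γ]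
    (φ : Rep0 X V Γ) {x y : X} (hx : x ∈ V) (hy : y ∈ V) (p : Path x y) : Γ :=
  MulOpposite.unop (φ.map (ObjectProperty.homMk
    (FundamentalGroupoid.fromPath (Path.Homotopic.Quotient.mk p)) :
      (⟨⟨x⟩, hx⟩ : (inVertices V).FullSubcategory) ⟶ ⟨⟨y⟩, hy⟩) : Γᵐᵒᵖ)

/-- The restriction `𝔅(X) → 𝔅⁰(X)`. -/
def Rep.restrict {X : Type*} [TopologicalSpace X] (V : Set X) {Γ : Type*} [Group Γ]
    (φ : Rep X Γ) : Rep0 X V Γ :=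
  (inVertices V).ι ⋙ φ

/-! ### Group cocycles and their evaluation on singular chains -/

/-- `k`-chains of the simplicial model of `BΓ`: formal integral combinations of `k`-tuples
`[x₁|⋯|x_k]`. -/
abbrev BarChain (Γ : Type*) (k : ℕ) : Type _ := (Fin k → Γ) →₀ ℤ

/-- `ξ ↦ ξ⟨φ⟩`, sending a singular simplex `σ` to `[φ(σ₀₁)|⋯|φ(σ_{k-1,k})]`. -/
def barChain {X : Type*} [TopologicalSpace X] {Γ : Type*} [Group Γ] (φ : Rep X Γ) (k : ℕ) :
    Chain X k →+ BarChain Γ k :=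
  Finsupp.mapDomain.addMonoidHom fun σ : Simplex X k =>
    fun i : Fin k => φ.val (edgePath σ i.castSucc i.succ)

/-- `α ∈ Z³(Γ; A)`. -/
def IsCocycle {Γ A : Type*} [Group Γ] [AddCommGroup A] (α : Γ → Γ → Γ → A) : Prop :=
  ∀ x y z w : Γ,
    α x y z - α (x * y) z w + α x (y * z) w - α x y (z * w) + α y z w = 0

/-- `α(x,y,z) = 0` whenever `1 ∈ {x, y, z, xy, yz}`. -/
def IsStronglyNormalized {Γ A : Type*} [Group Γ] [AddCommGroup A] (α : Γ → Γ → Γ → A) : Prop :=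
  ∀ x y z : Γ, (x = 1 ∨ y = 1 ∨ z = 1 ∨ x * y = 1 ∨ y * z = 1) → α x y z = 0

/-- The value of `α` on a 3-chain of `BΓ`. -/
def evalBar {Γ A : Type*} [AddCommGroup A] (α : Γ → Γ → Γ → A) : BarChain Γ 3 →+ A :=
  Finsupp.liftAddHom fun s : Fin 3 → Γ => zmultiplesHom A (α (s 0) (s 1) (s 2))

open Classical in
/-- `α^φ(ξ; ξ') = α(ζ⟨φ⟩)` for a 3-chain `ζ` with `∂ζ = ξ - ξ'`
(and the junk value `0` if there is no such `ζ`). -/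
def cycleCocycle {X : Type*} [TopologicalSpace X] {Γ A : Type*} [Group Γ] [AddCommGroup A]
    (α : Γ → Γ → Γ → A) (φ : Rep X Γ) (ξ ξ' : Chain X 2) : A :=
  if h : ∃ ζ : Chain X 3, boundary X 2 ζ = ξ - ξ' then evalBar α (barChain φ 3 h.choose) else 0

/-- `f : ℤ² → A` has the 3-cocycle `(a,b,c) ↦ α(z^a, z^b, z^c)` of `ℤ` as its coboundary. -/
def IsPrimitive {Γ A : Type*} [Group Γ] [AddCommGroup A] (α : Γ → Γ → Γ → A) (z : Γ)
    (f : ℤ → ℤ → A) : Prop :=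
  ∀ a b c : ℤ, α (z ^ a) (z ^ b) (z ^ c) = f b c - f (a + b) c + f a (b + c) - f a b

open Classical in
/-- `ε(z; a, b) = f_z(a, b) - f_z(b, a)` for a primitive `f_z` of `(a,b,c) ↦ α(z^a, z^b, z^c)`
(and the junk value `0` if there is no such `f_z`). -/
def epsilon {Γ A : Type*} [Group Γ] [AddCommGroup A] (α : Γ → Γ → Γ → A) (z : Γ) (a b : ℤ) : A :=
  if h : ∃ f : ℤ → ℤ → A, IsPrimitive α z f then h.choose a b - h.choose b a else 0

/-! ### The torus -/

/-- The torus `S¹ × S¹`, with `S¹ = ℝ/ℤ`. -/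
abbrev Torus : Type := UnitAddTorus (Fin 2)

/-- The universal covering `π : ℝ² → T²`. -/
def cover : C(Fin 2 → ℝ, Torus) where
  toFun v i := (v i : UnitAddCircle)
  continuous_toFun := continuous_pi fun i =>
    (AddCircle.continuous_mk' (1 : ℝ)).comp (continuous_apply i)

/-- The base point of the torus, the image of `ℤ²`. -/
abbrev basePoint : Torus := 0

/-- The simplex `[A₀ … A_k]` of the torus: `π` composed with the affine map `Δ^k → ℝ²` that
sends the vertex `vᵢ` to `Aᵢ ∈ ℤ²`. -/
def affineSimplex {k : ℕ} (P : Fin (k + 1) → Fin 2 → ℤ) : Simplex Torus k :=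
  cover.comp
    { toFun := fun t j => ∑ i, t.1 i * (P i j : ℝ)
      continuous_toFun := continuous_pi fun _ => continuous_finsetSum _ fun i _ =>
        ((continuous_apply i).comp continuous_subtype_val).mul continuous_const }

/-- `ξ^st = [O W₁ W₃] - [O W₂ W₃]`. -/
def xiSt : Chain Torus 2 :=
  Finsupp.single (affineSimplex ![![0, 0], ![1, 0], ![1, 1]]) 1
    - Finsupp.single (affineSimplex ![![0, 0], ![0, 1], ![1, 1]]) 1

/-- The self-map `â` of the torus induced by left multiplication by `a` on `ℝ²`. -/
def hat (a : Matrix.SpecialLinearGroup (Fin 2) ℤ) : C(Torus, Torus) where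
  toFun x i := ∑ j, a i j • x j
  continuous_toFun := by fun_prop

theorem hat_cover (a : Matrix.SpecialLinearGroup (Fin 2) ℤ) (v : Fin 2 → ℝ) :
    hat a (cover v) = cover ((a.1.map (fun n : ℤ => (n : ℝ))).mulVec v) := by
  funext i
  change ∑ j, a i j • ((v j : ℝ) : UnitAddCircle) =
    ((∑ j, ((a i j : ℤ) : ℝ) * v j : ℝ) : UnitAddCircle)
  simp only [Fin.sum_univ_two, ← zsmul_eq_mul]
  rfl

/-- The loop `t ↦ π(t v)` at the base point, for `v ∈ ℤ²`. -/
def straightLoop (v : Fin 2 → ℤ) : Path basePoint basePoint where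
  toFun t := cover fun j => (t : ℝ) * (v j : ℝ)
  continuous_toFun := by fun_prop
  source' := by funext j; simp [cover]
  target' := by
    funext j
    simp [cover]

/-- The meridian `S¹ × 1`. -/
def meridian : Path basePoint basePoint := straightLoop ![1, 0]

/-- The longitude `1 × S¹`. -/
def longitude : Path basePoint basePoint := straightLoop ![0, 1]

/-- `φ₀ = φ_z`: the element of `𝔅⁰(T²)` (with the base point as only vertex) is `1` on the
meridian and `z` on the longitude. -/
def IsPhi {Γ : Type*} [Group Γ] (z : Γ) (φ₀ : Rep0 Torus {basePoint} Γ) : Prop :=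
  φ₀.val (Set.mem_singleton _) (Set.mem_singleton _) meridian = 1 ∧
    φ₀.val (Set.mem_singleton _) (Set.mem_singleton _) longitude = z

end CycleCocycle

end

/-! The value is computed by trivialising `α` on the torus. Since `φ_z` factors through the powers
of `z`, a functor `φ` restricting to `φ_z` sends a path `p` to `g(x)⁻¹ z^n g(y)`. Here `n` is the
longitudinal displacement of `p`, and `g(x)` is the value of `φ` on a chosen path from the base
point to `x`. The cocycle `α` on powers of `z` is the coboundary of some `f`, because `H³(ℤ; A) =
0`, and the gauge change by `g` alters it by the coboundary of a prism sum (`IsCocycle.gauge`).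
Hence `ζ ↦ α(ζ⟨φ⟩)` is the coboundary of an explicit 2-cochain (`primitiveCochain_boundary`) and
depends only on `∂ζ`.

On affine triangles with lattice vertices the gauge terms vanish. So `â_# ξ^st` contributes `f(c,d)
- f(d,c)`, and `ξ^st` contributes `f(0,1) - f(1,0) = 0`.

That `â_# ξ^st` and `ξ^st` are homologous is a determinant argument: modulo boundaries, triangles
with edges `u`, `v` form a 2-cocycle on `ℤ²`. Its antisymmetrization is biadditive and alternating,
hence multiplied by `det a = 1` when the standard basis is replaced by the columns of `a`.
Biadditivity also shows that 2-cocycles on `ℤ` are symmetric, so `ε` is independent of `f`. -/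

noncomputable section

namespace CycleCocycle

/-! ### Antisymmetrized 2-cocycles on abelian groups -/

section Antisymmetrization

variable {G A : Type*} [AddCommGroup G] [AddCommGroup A]

/-- The cocycle identities for the three shuffles of `b` into `(a, a')`, taken with alternating
signs, cancel all other terms. -/
theorem cocycle_antisymm_add (s : G → G → A)
    (hs : ∀ a b c, s b c - s (a + b) c + s a (b + c) - s a b = 0) (a a' b : G) :
    s (a + a') b - s b (a + a') = (s a b - s b a) + (s a' b - s b a') := by
  have h₁ := hs a a' b
  have h₂ := hs a b a'
  have h₃ := hs b a a'
  rw [add_comm a' b] at h₁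
  rw [add_comm b a] at h₃
  rw [← sub_eq_zero, ← neg_eq_zero]
  calc _ = (s a' b - s (a + a') b + s a (b + a') - s a a')
        - (s b a' - s (a + b) a' + s a (b + a') - s a b)
        + (s a a' - s (a + b) a' + s b (a + a') - s b a) := by abel
    _ = 0 := by rw [h₁, h₂, h₃]; simp

/-- The antisymmetrization of a 2-cocycle on an abelian group is biadditive. -/
def cocycleAntisymm (s : G → G → A)
    (hs : ∀ a b c, s b c - s (a + b) c + s a (b + c) - s a b = 0) : G →+ G →+ A :=
  AddMonoidHom.mk' (fun a => AddMonoidHom.mk' (fun b => s a b - s b a) fun b b' => by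
    have := cocycle_antisymm_add s hs b b' a
    rw [← neg_inj, neg_sub, this]; abel) fun a a' => by
      ext b; exact cocycle_antisymm_add s hs a a' b

theorem cocycleAntisymm_apply (s : G → G → A)
    (hs : ∀ a b c, s b c - s (a + b) c + s a (b + c) - s a b = 0) (a b : G) :
    cocycleAntisymm s hs a b = s a b - s b a := rfl

/-- A biadditive map on `ℤ` is determined by its value at `(1, 1)`, where an antisymmetrization
vanishes. -/
theorem int_cocycle_symm (s : ℤ → ℤ → A)
    (hs : ∀ a b c, s b c - s (a + b) c + s a (b + c) - s a b = 0) (a b : ℤ) :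
    s a b = s b a := by
  have h : cocycleAntisymm s hs = 0 := by
    ext
    simp [cocycleAntisymm_apply]
  rw [← sub_eq_zero, ← cocycleAntisymm_apply s hs, h]
  rfl

theorem alternating_eq_det (w : (Fin 2 → ℤ) →+ (Fin 2 → ℤ) →+ A) (hw : ∀ u, w u u = 0)
    (u v : Fin 2 → ℤ) :
    w u v = (u 0 * v 1 - u 1 * v 0) • w ![1, 0] ![0, 1] := by
  have hsymm : w ![0, 1] ![1, 0] = - w ![1, 0] ![0, 1] := by
    have h := hw (![1, 0] + ![0, 1])
    simp only [map_add, AddMonoidHom.add_apply, hw] at h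
    rw [eq_neg_iff_add_eq_zero]
    simpa using h
  have hdec : ∀ x : Fin 2 → ℤ, x = x 0 • ![1, 0] + x 1 • ![0, 1] := fun x => by
    ext i; fin_cases i <;> simp
  conv_lhs => rw [hdec u, hdec v]
  simp only [map_add, map_zsmul, AddMonoidHom.add_apply, AddMonoidHom.smul_apply, hw, hsymm]
  module

end Antisymmetrization

/-! ### Primitives of `α` on powers of `z`, and gauge changes -/

section Primitive

variable {Γ A : Type*} [Group Γ] [AddCommGroup A]

theorem exists_int_antidifference (u : ℤ → A) :
    ∃ F : ℤ → A, F 0 = 0 ∧ ∀ n, F (n + 1) - F n = u n := by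
  -- At most one of the two sums is nonempty: the first serves `n > 0`, the second `n < 0`.
  refine ⟨fun n => ∑ j ∈ Finset.range n.toNat, u j
    - ∑ j ∈ Finset.range (-n).toNat, u (-1 - (j : ℤ)), by simp, fun n => ?_⟩
  obtain ⟨m, rfl | rfl⟩ : ∃ m : ℕ, n = m ∨ n = -1 - (m : ℤ) := by
    rcases le_or_gt 0 n with h | h
    · exact ⟨n.toNat, Or.inl (by omega)⟩
    · exact ⟨(-1 - n).toNat, Or.inr (by omega)⟩
  · have h₁ : ((m : ℤ) + 1).toNat = m + 1 := by omega
    have h₂ : (-(m : ℤ)).toNat = 0 := by omega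
    have h₃ : (-((m : ℤ) + 1)).toNat = 0 := by omega
    simp only [h₁, h₂, h₃, Int.toNat_natCast, Finset.sum_range_succ]
    simp
  · have h₁ : (-1 - (m : ℤ) + 1).toNat = 0 := by omega
    have h₂ : (-1 - (m : ℤ)).toNat = 0 := by omega
    have h₃ : (-(-1 - (m : ℤ) + 1)).toNat = m := by omega
    have h₄ : (-(-1 - (m : ℤ))).toNat = m + 1 := by omega
    simp only [h₁, h₂, h₃, h₄, Finset.sum_range_succ]
    simp

/-- With `f(a, 1) = 0`, the case `c = 1` of the required identity says that `f(a, ·)` is an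
antidifference of `α(z^a, z^·, z)`; this defines `f`. The cocycle identity with last argument `z`
then shows that the defect `e` is constant in `c`. -/
theorem exists_isPrimitive {α : Γ → Γ → Γ → A} (hα : IsCocycle α)
    (hα' : IsStronglyNormalized α) (z : Γ) : ∃ f : ℤ → ℤ → A, IsPrimitive α z f := by
  choose f hf₀ hf using fun a : ℤ =>
    exists_int_antidifference fun b : ℤ => α (z ^ a) (z ^ b) (z ^ (1 : ℤ))
  have hf₁ : ∀ a, f a 1 = 0 := fun a => by
    have h := hf a 0
    rw [zero_add, hf₀, sub_zero, zpow_zero, hα' _ _ _ (by simp)] at h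
    exact h
  refine ⟨f, fun a b c => ?_⟩
  rw [← sub_eq_zero]
  set e : ℤ → A := fun c => α (z ^ a) (z ^ b) (z ^ c)
    - (f b c - f (a + b) c + f a (b + c) - f a b) with he
  have hstep : ∀ n, e (n + 1) = e n := fun n => by
    have h := hα (z ^ a) (z ^ b) (z ^ n) (z ^ (1 : ℤ))
    simp only [← zpow_add] at h
    rw [← hf, ← hf, ← hf] at h
    rw [← sub_eq_zero, ← neg_eq_zero, ← h]
    simp only [he, ← add_assoc]
    abel
  have hone : e 1 = 0 := by
    have h := hf a b
    simp only [he, hf₁, ← h]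
    abel
  have hall : ∀ n, e n = 0 := fun n => by
    induction n using Int.inductionOn' (b := 1) with
    | zero => exact hone
    | succ k _ ih => rw [hstep, ih]
    | pred k _ ih => rw [← ih, ← hstep (k - 1), sub_add_cancel]
  exact hall c

theorem IsPrimitive.sub_swap_eq {α : Γ → Γ → Γ → A} {z : Γ} {f f' : ℤ → ℤ → A}
    (hf : IsPrimitive α z f) (hf' : IsPrimitive α z f') (m n : ℤ) :
    f m n - f n m = f' m n - f' n m := by
  have h := int_cocycle_symm (fun a b => f a b - f' a b) (fun a b c => by
    have h := (hf a b c).symm.trans (hf' a b c)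
    rw [← sub_eq_zero] at h
    rw [← h]
    abel) m n
  rw [sub_eq_sub_iff_add_eq_add] at h ⊢
  rw [h, add_comm]

theorem IsPrimitive.sub_swap_eq_epsilon {α : Γ → Γ → Γ → A} {z : Γ} {f : ℤ → ℤ → A}
    (hf : IsPrimitive α z f) (m n : ℤ) : f m n - f n m = epsilon α z m n := by
  have h : ∃ f : ℤ → ℤ → A, IsPrimitive α z f := ⟨f, hf⟩
  rw [epsilon, dif_pos h]
  exact hf.sub_swap_eq h.choose_spec m n

theorem IsPrimitive.zero_left {α : Γ → Γ → Γ → A} (hα' : IsStronglyNormalized α) {z : Γ}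
    {f : ℤ → ℤ → A} (hf : IsPrimitive α z f) (n : ℤ) : f 0 n = f 0 0 := by
  have h := hf 0 0 n
  rw [hα' _ _ _ (by simp)] at h
  simpa [sub_eq_zero] using h.symm

theorem IsPrimitive.zero_right {α : Γ → Γ → Γ → A} (hα' : IsStronglyNormalized α) {z : Γ}
    {f : ℤ → ℤ → A} (hf : IsPrimitive α z f) (n : ℤ) : f n 0 = f 0 0 := by
  have h := hf n 0 0
  rw [hα' _ _ _ (by simp)] at h
  simpa [sub_eq_zero, eq_comm (a := f 0 0)] using h.symm

/-- The sum of `α` over the prism with bottom edges `x`, `y` and vertical edges `g₀`, `g₁`,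
`g₂`. -/
def prism (α : Γ → Γ → Γ → A) (x y g₀ g₁ g₂ : Γ) : A :=
  α x y g₂ - α x g₁ (g₁⁻¹ * y * g₂) + α g₀ (g₀⁻¹ * x * g₁) (g₁⁻¹ * y * g₂)

/-- The prism over a tetrahedron splits into four 4-simplices; in the alternating sum of their
cocycle identities the interior tetrahedra cancel. -/
theorem IsCocycle.gauge {α : Γ → Γ → Γ → A} (hα : IsCocycle α) (x y w g₀ g₁ g₂ g₃ : Γ) :
    α (g₀⁻¹ * x * g₁) (g₁⁻¹ * y * g₂) (g₂⁻¹ * w * g₃) = α x y w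
      + (prism α y w g₁ g₂ g₃ - prism α (x * y) w g₀ g₂ g₃ + prism α x (y * w) g₀ g₁ g₃
        - prism α x y g₀ g₁ g₂) := by
  have h₀ := hα g₀ (g₀⁻¹ * x * g₁) (g₁⁻¹ * y * g₂) (g₂⁻¹ * w * g₃)
  have h₁ := hα x g₁ (g₁⁻¹ * y * g₂) (g₂⁻¹ * w * g₃)
  have h₂ := hα x y g₂ (g₂⁻¹ * w * g₃)
  have h₃ := hα x y w g₃
  simp only [prism]
  simp only [mul_assoc, mul_inv_cancel_left] at h₀ h₁ h₂ h₃ ⊢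
  linear_combination (norm := abel) h₀ - h₁ + h₂ - h₃

end Primitive

/-! ### Path lifting to the plane -/

section Lifts

theorem cover_surjective : Function.Surjective cover := fun x => by
  choose v hv using fun i => QuotientAddGroup.mk_surjective (x i)
  exact ⟨v, funext hv⟩

theorem cover_eq_cover_iff {v w : Fin 2 → ℝ} :
    cover v = cover w ↔ ∃ n : Fin 2 → ℤ, v = w + fun i => (n i : ℝ) := by
  constructor
  · intro h
    have h' : ∀ i, ∃ n : ℤ, v i = w i + n := fun i => by
      have hi : ((v i : ℝ) : UnitAddCircle) = (w i : ℝ) := congrFun h i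
      obtain ⟨n, hn⟩ := AddSubgroup.mem_zmultiples_iff.1 (QuotientAddGroup.eq_iff_sub_mem.1 hi)
      exact ⟨n, by rw [zsmul_one] at hn; linarith⟩
    choose n hn using h'
    exact ⟨n, funext hn⟩
  · rintro ⟨n, rfl⟩
    funext i
    change ((w i + n i : ℝ) : UnitAddCircle) = (w i : ℝ)
    simp

theorem exists_torusSection : ∃ s : Torus → Fin 2 → ℝ, s 0 = 0 ∧ ∀ x, cover (s x) = x := by
  classical
  choose s hs using cover_surjective
  refine ⟨Function.update s 0 0, by simp, fun x => ?_⟩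
  by_cases h : x = 0
  · subst h
    funext i
    simp [cover]
  · simp [h, hs]

/-- A set-theoretic section of the universal covering sending the base point to the origin. -/
def torusSection : Torus → Fin 2 → ℝ := exists_torusSection.choose

theorem torusSection_zero : torusSection 0 = 0 := exists_torusSection.choose_spec.1

theorem cover_torusSection (x : Torus) : cover (torusSection x) = x :=
  exists_torusSection.choose_spec.2 x

/-- `q` is a lift of `p` to the universal covering of the torus. -/
def IsLift {x y : Torus} (p : Path x y) {v w : Fin 2 → ℝ} (q : Path v w) : Prop :=
  ∀ t, cover (q t) = p t

variable {x y w : Torus} {p p' : Path x y} {u v v' : Fin 2 → ℝ}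

theorem exists_isLift (p : Path x y) (hv : cover v = x) :
    ∃ (u : Fin 2 → ℝ) (q : Path v u), IsLift p q := by
  have h (i : Fin 2) := (AddCircle.isCoveringMap_coe (1 : ℝ)).exists_path_lifts
    ⟨fun t => p t i, (continuous_apply i).comp p.continuous⟩ (v i)
    (by change p 0 i = _; rw [p.source, ← hv]; rfl)
  choose q hq hq₀ using h
  refine ⟨fun i => q i 1, ⟨⟨fun t i => q i t, by fun_prop⟩, funext hq₀, rfl⟩, fun t => ?_⟩
  funext i
  exact congrFun (hq i) t

/-- Coordinatewise, this is homotopy invariance of monodromy for `ℝ → ℝ/ℤ`. -/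
theorem IsLift.target_eq {q : Path u v} {q' : Path u v'} (hq : IsLift p q) (hq' : IsLift p' q')
    (h : p.Homotopic p') : v = v' := by
  funext i
  have hc := AddCircle.isCoveringMap_coe (1 : ℝ)
  have hγ {a : Fin 2 → ℝ} {r : Path x y} {r' : Path u a} (hr : IsLift r r') :
      (⟨fun t => r t i, (continuous_apply i).comp r.continuous⟩ : C(unitInterval, UnitAddCircle)) 0 = u i := by
    have := congrFun (hr 0) i
    rw [r'.source] at this
    exact this.symm
  have hlift {a : Fin 2 → ℝ} {r : Path x y} {r' : Path u a} (hr : IsLift r r') :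
      a i = hc.liftPath _ (u i) (hγ hr) 1 := by
    rw [← (hc.eq_liftPath_iff' (hγ hr)
      (Γ := ⟨fun t => r' t i, (continuous_apply i).comp r'.continuous⟩)).2
      ⟨funext fun t => congrFun (hr t) i, by simp⟩]
    simp
  rw [hlift hq, hlift hq']
  exact hc.liftPath_apply_one_eq_of_homotopicRel
    (ContinuousMap.HomotopicRel.comp_continuousMap h
      ⟨fun a : Torus => a i, continuous_apply i⟩) (u i) (hγ hq) (hγ hq')

/-- Lifts with common endpoints are homotopic in the simply connected plane, and the homotopy
projects to the torus. -/
theorem IsLift.homotopic {q q' : Path u v} (hq : IsLift p q) (hq' : IsLift p' q') :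
    p.Homotopic p' := by
  have h := (SimplyConnectedSpace.paths_homotopic q q').map cover
  obtain rfl : cover u = x := by simpa using hq 0
  obtain rfl : cover v = y := by simpa using hq 1
  have h₁ : p = q.map cover.continuous := Path.ext (funext fun t => (hq t).symm)
  have h₂ : p' = q'.map cover.continuous := Path.ext (funext fun t => (hq' t).symm)
  rw [h₁, h₂]
  exact h

theorem IsLift.trans {p : Path x y} {p' : Path y w} {q : Path u v} {q' : Path v v'}
    (hq : IsLift p q) (hq' : IsLift p' q') : IsLift (p.trans p') (q.trans q') := fun t => by
  simp only [Path.trans_apply]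
  split_ifs
  · exact hq _
  · exact hq' _

theorem isLift_translate {p : Path x y} {q : Path u v} (hq : IsLift p q) (n : Fin 2 → ℤ) :
    IsLift p (q.map (continuous_add_const fun i => (n i : ℝ))) := fun t => by
  rw [← hq t]
  exact cover_eq_cover_iff.2 ⟨n, rfl⟩

end Lifts

/-! ### Integral displacement of paths -/

section Winding

variable {x y w : Torus} {p p' : Path x y} {u v v' : Fin 2 → ℝ}

theorem exists_winding (p : Path x y) : ∃ (n : Fin 2 → ℤ)
    (q : Path (torusSection x) (torusSection y + fun i => (n i : ℝ))), IsLift p q := by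
  obtain ⟨u, q, hq⟩ := exists_isLift p (cover_torusSection x)
  have h : cover u = cover (torusSection y) := by
    rw [cover_torusSection]; simpa using hq 1
  obtain ⟨n, rfl⟩ := cover_eq_cover_iff.1 h
  exact ⟨n, q, hq⟩

/-- The integral displacement of a path in the torus, relative to the section. -/
def winding (p : Path x y) : Fin 2 → ℤ := (exists_winding p).choose

theorem exists_isLift_winding (p : Path x y) :
    ∃ q : Path (torusSection x) (torusSection y + fun i => (winding p i : ℝ)), IsLift p q :=
  (exists_winding p).choose_spec

/-- Any lift computes the displacement: a lattice translation moves its start to the section. -/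
theorem IsLift.winding_eq {q : Path u v} (hq : IsLift p' q) (h : p.Homotopic p') (i : Fin 2) :
    (winding p i : ℝ) = (v i - torusSection y i) - (u i - torusSection x i) := by
  have hu : cover (torusSection x) = cover u := by
    rw [cover_torusSection]; simpa using (hq 0).symm
  obtain ⟨n, hn⟩ := cover_eq_cover_iff.1 hu
  obtain ⟨r, hr⟩ := exists_isLift_winding p
  have hq' := isLift_translate hq n
  -- The endpoints occur in the type of the path, so they are generalised before the starting points
  -- are identified.
  have key : ∀ {a b : Fin 2 → ℝ} (q' : Path a b), IsLift p' q' → a = torusSection x →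
      torusSection y + (fun i => (winding p i : ℝ)) = b := by
    rintro a b q' hq' rfl
    exact hr.target_eq hq' h
  have h₁ := congrFun (key _ hq' hn.symm) i
  have h₂ := congrFun hn i
  simp only [Pi.add_apply] at h₁ h₂
  linarith

theorem winding_congr (h : p.Homotopic p') : winding p = winding p' := by
  obtain ⟨q, hq⟩ := exists_isLift_winding p'
  funext i
  have := hq.winding_eq h i
  simp only [Pi.add_apply] at this
  exact_mod_cast (by linarith : (winding p i : ℝ) = winding p' i)

theorem winding_trans (p : Path x y) (p' : Path y w) :
    winding (p.trans p') = winding p + winding p' := by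
  obtain ⟨q, hq⟩ := exists_isLift_winding p
  obtain ⟨u, q', hq'⟩ := exists_isLift p' (by simpa using hq 1 : cover _ = y)
  funext i
  have h₁ := (hq.trans hq').winding_eq (.refl _) i
  have h₂ := hq'.winding_eq (.refl _) i
  simp only [Pi.add_apply] at h₁ h₂ ⊢
  exact_mod_cast (by linarith : (winding (p.trans p') i : ℝ) = winding p i + winding p' i)

theorem winding_refl (x : Torus) : winding (Path.refl x) = 0 := by
  have h := winding_congr ⟨Path.Homotopy.reflTrans (Path.refl x)⟩
  rw [winding_trans] at h
  simpa using h

/-- The functor sending a path to `z ^ n`, where `n` is its displacement in the direction of the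
longitude. -/
def windingRep {Γ : Type*} [Group Γ] (z : Γ) : Rep Torus Γ where
  obj _ := SingleObj.star _
  map f := MulOpposite.op (Quotient.lift (fun p => z ^ (winding p 1))
    (fun _ _ h => by rw [winding_congr h]) f)
  map_id x := by
    change MulOpposite.op (z ^ (winding (Path.refl x.as) 1)) = _
    rw [winding_refl]
    simp
    rfl
  map_comp f g := by
    induction f using Path.Homotopic.Quotient.ind
    induction g using Path.Homotopic.Quotient.ind
    rename_i p q
    change MulOpposite.op (z ^ (winding (p.trans q) 1)) =
      MulOpposite.op (z ^ (winding q 1)) * MulOpposite.op (z ^ (winding p 1))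
    rw [winding_trans, Pi.add_apply, zpow_add]
    rfl

theorem windingRep_val {Γ : Type*} [Group Γ] (z : Γ) (p : Path x y) :
    (windingRep z).val p = z ^ (winding p 1) := rfl

end Winding

/-! ### Functors restricting to `φ_z` -/

section Representations

theorem Rep.val_eq_of_homotopic {X Γ : Type*} [TopologicalSpace X] [Group Γ] (φ : Rep X Γ)
    {x y : X} {p p' : Path x y} (h : p.Homotopic p') : φ.val p = φ.val p' := by
  rw [Rep.val, Rep.val, Path.Homotopic.Quotient.eq.2 h]

theorem Rep.val_refl {X Γ : Type*} [TopologicalSpace X] [Group Γ] (φ : Rep X Γ) (x : X) :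
    φ.val (Path.refl x) = 1 := by
  have h := φ.val_trans (Path.refl x) (Path.refl x)
  rw [φ.val_eq_of_homotopic ⟨Path.Homotopy.reflTrans (Path.refl x)⟩] at h
  simpa using h

theorem Rep0.val_eq_of_homotopic {X Γ : Type*} [TopologicalSpace X] {V : Set X} [Group Γ]
    (φ : Rep0 X V Γ) {x y : X} (hx : x ∈ V) (hy : y ∈ V) {p p' : Path x y}
    (h : p.Homotopic p') : φ.val hx hy p = φ.val hx hy p' := by
  rw [Rep0.val, Rep0.val, Path.Homotopic.Quotient.eq.2 h]

theorem Rep0.val_trans {X Γ : Type*} [TopologicalSpace X] {V : Set X} [Group Γ]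
    (φ : Rep0 X V Γ) {x y w : X} (hx : x ∈ V) (hy : y ∈ V) (hw : w ∈ V) (p : Path x y)
    (q : Path y w) : φ.val hx hw (p.trans q) = φ.val hx hy p * φ.val hy hw q :=
  congrArg MulOpposite.unop (φ.map_comp
    (ObjectProperty.homMk (FundamentalGroupoid.fromPath (Path.Homotopic.Quotient.mk p)) :
      (⟨⟨x⟩, hx⟩ : (inVertices V).FullSubcategory) ⟶ ⟨⟨y⟩, hy⟩)
    (ObjectProperty.homMk (FundamentalGroupoid.fromPath (Path.Homotopic.Quotient.mk q)) :
      (⟨⟨y⟩, hy⟩ : (inVertices V).FullSubcategory) ⟶ ⟨⟨w⟩, hw⟩))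

theorem exists_isLift_straightLoop (v : Fin 2 → ℤ) :
    ∃ q : Path (0 : Fin 2 → ℝ) (fun i => (v i : ℝ)), IsLift (straightLoop v) q :=
  ⟨⟨⟨fun t j => (t : ℝ) * (v j : ℝ), by fun_prop⟩, by funext j; simp, by funext j; simp⟩,
    fun _ => rfl⟩

theorem winding_straightLoop (v : Fin 2 → ℤ) : winding (straightLoop v) = v := by
  obtain ⟨q, hq⟩ := exists_isLift_straightLoop v
  funext i
  have h := hq.winding_eq (.refl _) i
  simpa [torusSection_zero] using h

/-- Both loops lift to paths from the origin to the same lattice point, since the section sends the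
base point to the origin. -/
theorem homotopic_straightLoop_winding (p : Path basePoint basePoint) :
    p.Homotopic (straightLoop (winding p)) := by
  obtain ⟨q, hq⟩ := exists_isLift_winding p
  obtain ⟨q', hq'⟩ := exists_isLift_straightLoop (winding p)
  exact IsLift.homotopic (q := q.cast torusSection_zero.symm (by simp [torusSection_zero])) hq hq'

theorem loop_homotopic_iff_winding_eq {p p' : Path basePoint basePoint} :
    p.Homotopic p' ↔ winding p = winding p' :=
  ⟨winding_congr, fun h => (homotopic_straightLoop_winding p).trans
    (h ▸ (homotopic_straightLoop_winding p').symm)⟩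

variable {Γ : Type*} [Group Γ] {z : Γ}

/-- The homomorphism from `ℤ²` given by the values of a representation on straight loops. -/
def Rep0.latticeHom (φ₀ : Rep0 Torus {basePoint} Γ) : Multiplicative (Fin 2 → ℤ) →* Γ :=
  MonoidHom.mk' (fun v => φ₀.val (Set.mem_singleton _) (Set.mem_singleton _)
    (straightLoop v.toAdd)) fun u v => by
      rw [← Rep0.val_trans]
      refine Rep0.val_eq_of_homotopic _ _ _ (loop_homotopic_iff_winding_eq.2 ?_)
      rw [winding_trans]
      simp only [winding_straightLoop]
      rfl

theorem IsPhi.val_loop {φ₀ : Rep0 Torus {basePoint} Γ} (h : IsPhi z φ₀)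
    (p : Path basePoint basePoint) :
    φ₀.val (Set.mem_singleton _) (Set.mem_singleton _) p = z ^ (winding p 1) := by
  rw [Rep0.val_eq_of_homotopic _ _ _ (homotopic_straightLoop_winding p)]
  change φ₀.latticeHom (Multiplicative.ofAdd (winding p)) = _
  have hdec : winding p = winding p 0 • ![1, 0] + winding p 1 • ![0, 1] := by
    ext i; fin_cases i <;> simp
  rw [hdec, ofAdd_add, map_mul, ofAdd_zsmul, ofAdd_zsmul, map_zpow, map_zpow]
  have h₁ : φ₀.latticeHom (Multiplicative.ofAdd ![1, 0]) = 1 := h.1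
  have h₂ : φ₀.latticeHom (Multiplicative.ofAdd ![0, 1]) = z := h.2
  rw [h₁, h₂]
  simp

theorem windingRep_isPhi (z : Γ) : IsPhi z ((windingRep z).restrict {basePoint}) := by
  constructor
  · change (windingRep z).val meridian = 1
    rw [windingRep_val, meridian, winding_straightLoop]
    simp
  · change (windingRep z).val longitude = z
    rw [windingRep_val, longitude, winding_straightLoop]
    simp

theorem IsPhi.unique {φ₀ φ₁ : Rep0 Torus {basePoint} Γ} (h₀ : IsPhi z φ₀) (h₁ : IsPhi z φ₁) :
    φ₀ = φ₁ := by
  refine CategoryTheory.Functor.ext (fun _ => rfl) ?_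
  rintro ⟨⟨x⟩, hx⟩ ⟨⟨y⟩, hy⟩ ⟨f⟩
  obtain rfl : x = basePoint := hx
  obtain rfl : y = basePoint := hy
  induction f using Path.Homotopic.Quotient.ind with | mk p =>
  have h := (h₀.val_loop p).trans (h₁.val_loop p).symm
  simp only [eqToHom_refl, Category.comp_id, Category.id_comp]
  exact MulOpposite.unop_injective h

/-- A path from the base point to `x`, with a lift that ends at the chosen point over `x`. -/
def basePath (x : Torus) : Path basePoint x :=
  ((PathConnectedSpace.somePath 0 (torusSection x)).map cover.continuous).cast
    (by funext i; simp [cover]) (cover_torusSection x).symm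

theorem basePath_isLift (x : Torus) :
    IsLift (basePath x) (PathConnectedSpace.somePath 0 (torusSection x)) := fun _ => rfl

theorem Rep.val_basePath_zero (φ : Rep Torus Γ) : φ.val (basePath basePoint) = 1 := by
  rw [← φ.val_refl basePoint]
  refine φ.val_eq_of_homotopic (IsLift.homotopic (q := (PathConnectedSpace.somePath 0
    (torusSection 0)).cast rfl torusSection_zero.symm) (basePath_isLift 0)
    (q' := Path.refl 0) fun t => ?_)
  funext i
  simp [cover]

/-- `φ` is the gauge transform of `windingRep z` by its values on base paths: the base path to `x`
followed by `p`, and the straight loop of `p` followed by the base path to `y`, have lifts with the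
same endpoints. -/
theorem IsPhi.val_eq {φ : Rep Torus Γ} (h : IsPhi z (φ.restrict {basePoint})) {x y : Torus}
    (p : Path x y) :
    φ.val p = (φ.val (basePath x))⁻¹ * z ^ (winding p 1) * φ.val (basePath y) := by
  have hloop : φ.val (straightLoop (winding p)) = z ^ (winding p 1) := by
    rw [← winding_straightLoop (winding p), ← h.val_loop, winding_straightLoop]
    rfl
  rw [mul_assoc, eq_inv_mul_iff_mul_eq, ← hloop, ← φ.val_trans, ← φ.val_trans]
  obtain ⟨q, hq⟩ := exists_isLift_winding p
  obtain ⟨q', hq'⟩ := exists_isLift_straightLoop (winding p)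
  refine φ.val_eq_of_homotopic (IsLift.homotopic ((basePath_isLift x).trans hq)
    (q' := (q'.trans (((PathConnectedSpace.somePath 0 (torusSection y)).map
      (continuous_add_const fun i => (winding p i : ℝ))).cast (by simp) rfl))) (hq'.trans ?_))
  exact isLift_translate (basePath_isLift y) (winding p)

end Representations

/-! ### Edges and faces of affine simplices -/

section Simplices

instance (k : ℕ) : ContractibleSpace (stdSimplex ℝ (Fin (k + 1))) :=
  (convex_stdSimplex ℝ (Fin (k + 1))).contractibleSpace ⟨_, single_mem_stdSimplex ℝ 0⟩

theorem edgePath_homotopic_trans {X : Type*} [TopologicalSpace X] {k : ℕ} (σ : Simplex X k)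
    (i j l : Fin (k + 1)) :
    (edgePath σ i l).Homotopic ((edgePath σ i j).trans (edgePath σ j l)) := by
  have h := (SimplyConnectedSpace.paths_homotopic (edge k i l)
    ((edge k i j).trans (edge k j l))).map σ
  rwa [Path.map_trans] at h

theorem face_vertex (k : ℕ) (i : Fin (k + 2)) (j : Fin (k + 1)) :
    face k i (stdSimplex.vertex j) = stdSimplex.vertex (i.succAbove j) :=
  stdSimplex.map_vertex _ _

theorem face_edge (k : ℕ) (i : Fin (k + 2)) (j l : Fin (k + 1)) (t : unitInterval) :
    face k i (edge k j l t) = edge (k + 1) (i.succAbove j) (i.succAbove l) t := by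
  refine Subtype.ext ((stdSimplex.map_coe i.succAbove (edge k j l t)).trans ?_)
  have h (n : ℕ) (j l : Fin (n + 1)) : ⇑(edge n j l t) =
    (1 - (t : ℝ)) • Pi.single j (1 : ℝ) + (t : ℝ) • Pi.single l (1 : ℝ) := rfl
  rw [h, map_add, map_smul, map_smul, FunOnFinite.linearMap_piSingle,
    FunOnFinite.linearMap_piSingle, ← h]
  rfl

theorem sum_stdSimplex_map {ι κ : Type*} [Fintype ι] [Fintype κ] [DecidableEq κ] (f : ι → κ)
    (t : ι → ℝ) (w : κ → ℝ) :
    ∑ j, FunOnFinite.linearMap ℝ ℝ f t j * w j = ∑ i, t i * w (f i) := by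
  simp only [FunOnFinite.linearMap_apply_apply, Finset.sum_mul]
  rw [← Finset.sum_fiberwise Finset.univ f]
  refine Finset.sum_congr rfl fun j _ => Finset.sum_congr rfl fun i hi => ?_
  rw [(Finset.mem_filter.1 hi).2]

theorem affineSimplex_comp_face {k : ℕ} (P : Fin (k + 2) → Fin 2 → ℤ) (i : Fin (k + 2)) :
    (affineSimplex P).comp (face k i) = affineSimplex (P ∘ i.succAbove) := by
  ext1 t
  refine congrArg cover (funext fun j => ?_)
  exact sum_stdSimplex_map i.succAbove t.1 fun l => (P l j : ℝ)

theorem affineSimplex_add {k : ℕ} (P : Fin (k + 1) → Fin 2 → ℤ) (v : Fin 2 → ℤ) :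
    affineSimplex (fun i => P i + v) = affineSimplex P := by
  ext1 t
  refine cover_eq_cover_iff.2 ⟨v, funext fun j => ?_⟩
  have ht : ∑ i, t.1 i = 1 := t.2.2
  change ∑ i, t.1 i * (((P i + v) j : ℤ) : ℝ) = ∑ i, t.1 i * (P i j : ℝ) + (v j : ℝ)
  simp only [Pi.add_apply, Int.cast_add, mul_add, Finset.sum_add_distrib, ← Finset.sum_mul, ht,
    one_mul]

theorem hat_comp_affineSimplex {k : ℕ} (a : Matrix.SpecialLinearGroup (Fin 2) ℤ)
    (P : Fin (k + 1) → Fin 2 → ℤ) :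
    (hat a).comp (affineSimplex P) = affineSimplex fun i => a.1.mulVec (P i) := by
  ext1 t
  refine (hat_cover a _).trans (congrArg cover (funext fun j => ?_))
  change ∑ m, (a.1 j m : ℝ) * (∑ i, t.1 i * (P i m : ℝ)) =
    ∑ i, t.1 i * ((∑ m, a.1 j m * P i m : ℤ) : ℝ)
  simp only [Int.cast_sum, Int.cast_mul, Finset.mul_sum]
  rw [Finset.sum_comm]
  exact Finset.sum_congr rfl fun _ _ => Finset.sum_congr rfl fun _ _ => mul_left_comm _ _ _

theorem affineSimplex_vertex {k : ℕ} (P : Fin (k + 1) → Fin 2 → ℤ) (i : Fin (k + 1)) :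
    affineSimplex P (stdSimplex.vertex i) = basePoint := by
  have h : (0 : Torus) = cover 0 := by funext i; simp [cover]
  rw [basePoint, h]
  refine cover_eq_cover_iff.2 ⟨P i, funext fun j => ?_⟩
  change ∑ l, (Pi.single i (1 : ℝ) : Fin (k + 1) → ℝ) l * (P l j : ℝ) = 0 + (P i j : ℝ)
  simp [Pi.single_apply]

theorem winding_edgePath_affineSimplex {k : ℕ} (P : Fin (k + 1) → Fin 2 → ℤ)
    (i j : Fin (k + 1)) : winding (edgePath (affineSimplex P) i j) = P j - P i := by
  let q : Path (fun l => (P i l : ℝ)) (fun l => (P j l : ℝ)) :=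
    ⟨⟨fun t l => (1 - (t : ℝ)) * (P i l : ℝ) + (t : ℝ) * (P j l : ℝ), by fun_prop⟩,
      by funext l; simp, by funext l; simp⟩
  have hq : IsLift (edgePath (affineSimplex P) i j) q := fun t => by
    refine congrArg cover (funext fun l => ?_)
    change (1 - (t : ℝ)) * (P i l : ℝ) + (t : ℝ) * (P j l : ℝ) =
      ∑ m, ((1 - (t : ℝ)) • (Pi.single i (1 : ℝ) : Fin (k + 1) → ℝ)
        + (t : ℝ) • (Pi.single j (1 : ℝ) : Fin (k + 1) → ℝ)) m * (P m l : ℝ)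
    simp [Pi.single_apply, add_mul, Finset.sum_add_distrib]
  funext l
  have h := hq.winding_eq (.refl _) l
  have hv := affineSimplex_vertex P
  simp only [Pi.sub_apply]
  -- All vertices map to the base point, so the two section terms in `h` cancel.
  have hi := congrFun (congrArg torusSection (hv i)) l
  have hj := congrFun (congrArg torusSection (hv j)) l
  exact_mod_cast (by linarith :
    (winding (edgePath (affineSimplex P) i j) l : ℝ) = P j l - P i l)

theorem boundary_single {X : Type*} [TopologicalSpace X] (k : ℕ) (σ : Simplex X (k + 1)) :
    boundary X k (Finsupp.single σ 1) =
      ∑ i : Fin (k + 2), (-1 : ℤ) ^ (i : ℕ) • Finsupp.single (σ.comp (face k i)) (1 : ℤ) := by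
  simp [boundary]

theorem boundary_two_single {X : Type*} [TopologicalSpace X] (σ : Simplex X 3) :
    boundary X 2 (Finsupp.single σ 1) =
      Finsupp.single (σ.comp (face 2 0)) 1 - Finsupp.single (σ.comp (face 2 1)) 1
        + Finsupp.single (σ.comp (face 2 2)) 1 - Finsupp.single (σ.comp (face 2 3)) 1 := by
  refine (boundary_single 2 σ).trans ((Fin.sum_univ_four _).trans ?_)
  simp only [Fin.val_zero, Fin.val_one, Fin.val_two, show ((3 : Fin 4) : ℕ) = 3 from rfl]
  module

end Simplices

/-! ### `â_# ξ^st` is homologous to `ξ^st` -/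

section Homology

/-- The class modulo boundaries of the triangle in the torus with edges `u`, `v`, `u + v`. -/
def triangleClass (u v : Fin 2 → ℤ) : Chain Torus 2 ⧸ (boundary Torus 2).range :=
  QuotientAddGroup.mk (Finsupp.single (affineSimplex ![0, u, u + v]) 1)

/-- This is the boundary of the tetrahedron `[0, u, u+v, u+v+w]`. Its face opposite `0` is a lattice
translate of `[0, v, v+w]`, hence the same simplex of the torus. -/
theorem triangleClass_cocycle (u v w : Fin 2 → ℤ) :
    triangleClass v w - triangleClass (u + v) w + triangleClass u (v + w) - triangleClass u v
      = 0 := by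
  have h : (QuotientAddGroup.mk (boundary Torus 2
      (Finsupp.single (affineSimplex ![0, u, u + v, u + v + w]) 1)) :
      Chain Torus 2 ⧸ (boundary Torus 2).range) = 0 :=
    (QuotientAddGroup.eq_zero_iff _).2 ⟨_, rfl⟩
  rw [boundary_two_single] at h
  simp only [affineSimplex_comp_face] at h
  have h₀ : (![0, u, u + v, u + v + w] ∘ (0 : Fin 4).succAbove) =
      fun i => ![0, v, v + w] i + u := by
    funext i; fin_cases i <;> simp <;> abel
  have h₁ : (![0, u, u + v, u + v + w] ∘ (1 : Fin 4).succAbove) = ![0, u + v, u + v + w] := by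
    funext i; fin_cases i <;> simp [Fin.succAbove]
  have h₂ : (![0, u, u + v, u + v + w] ∘ (2 : Fin 4).succAbove) = ![0, u, u + (v + w)] := by
    funext i; fin_cases i <;> simp [Fin.succAbove, add_assoc]
  have h₃ : (![0, u, u + v, u + v + w] ∘ (3 : Fin 4).succAbove) = ![0, u, u + v] := by
    funext i; fin_cases i <;> simp [Fin.succAbove]
  rw [h₀, h₁, h₂, h₃, affineSimplex_add] at h
  exact h

/-- In this form its class is the antisymmetrized `triangleClass` at the columns of `a`. -/
theorem pushforward_xiSt (a : Matrix.SpecialLinearGroup (Fin 2) ℤ) :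
    pushforward (hat a) 2 xiSt =
      Finsupp.single (affineSimplex ![0, ![a 0 0, a 1 0], ![a 0 0, a 1 0] + ![a 0 1, a 1 1]]) 1
      - Finsupp.single
        (affineSimplex ![0, ![a 0 1, a 1 1], ![a 0 1, a 1 1] + ![a 0 0, a 1 0]]) 1 := by
  simp only [xiSt, map_sub, pushforward, Finsupp.mapDomain.addMonoidHom_apply,
    Finsupp.mapDomain_single, hat_comp_affineSimplex]
  congr 3
  · funext i j
    fin_cases i <;> fin_cases j <;> simp [Matrix.mulVec, dotProduct]
  · funext i j
    fin_cases i <;> fin_cases j <;> simp [Matrix.mulVec, dotProduct, add_comm]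

theorem xiSt_eq : xiSt = Finsupp.single (affineSimplex ![0, ![1, 0], ![1, 0] + ![0, 1]]) 1
      - Finsupp.single (affineSimplex ![0, ![0, 1], ![0, 1] + ![1, 0]]) 1 := by
  have h₁ : (![![0, 0], ![1, 0], ![1, 1]] : Fin 3 → Fin 2 → ℤ) =
      ![0, ![1, 0], ![1, 0] + ![0, 1]] := by
    funext i j
    fin_cases i <;> fin_cases j <;> simp
  have h₂ : (![![0, 0], ![0, 1], ![1, 1]] : Fin 3 → Fin 2 → ℤ) =
      ![0, ![0, 1], ![0, 1] + ![1, 0]] := by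
    funext i j
    fin_cases i <;> fin_cases j <;> simp
  rw [xiSt, h₁, h₂]

theorem exists_boundary_eq_hat_sub (a : Matrix.SpecialLinearGroup (Fin 2) ℤ) :
    ∃ ζ : Chain Torus 3, boundary Torus 2 ζ = pushforward (hat a) 2 xiSt - xiSt := by
  have h : pushforward (hat a) 2 xiSt - xiSt ∈ (boundary Torus 2).range := by
    rw [← QuotientAddGroup.eq_zero_iff, QuotientAddGroup.mk_sub, sub_eq_zero, pushforward_xiSt,
      xiSt_eq]
    have hdet : a 0 0 * a 1 1 - a 0 1 * a 1 0 = 1 := (Matrix.det_fin_two a.1).symm.trans a.2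
    have hw := alternating_eq_det (cocycleAntisymm triangleClass triangleClass_cocycle)
      (fun u => sub_self _) ![a 0 0, a 1 0] ![a 0 1, a 1 1]
    have hone : ![a 0 0, a 1 0] 0 * ![a 0 1, a 1 1] 1 - ![a 0 0, a 1 0] 1 * ![a 0 1, a 1 1] 0
        = 1 := by
      refine Eq.trans ?_ hdet
      rw [mul_comm (a 0 1)]; rfl
    rw [hone, one_smul] at hw
    exact hw
  exact h

end Homology

/-! ### Evaluation by a 2-cochain -/

section Evaluation

variable {Γ A : Type*} [Group Γ] [AddCommGroup A]

theorem winding_congr_fun {x y x' y' : Torus} {p : Path x y} {p' : Path x' y'}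
    (h : ∀ t, p t = p' t) : winding p = winding p' := by
  obtain rfl : x = x' := by simpa using h 0
  obtain rfl : y = y' := by simpa using h 1
  rw [Path.ext (funext h)]

theorem winding_edgePath_face {k : ℕ} (σ : Simplex Torus (k + 1)) (i : Fin (k + 2))
    (j l : Fin (k + 1)) :
    winding (edgePath (σ.comp (face k i)) j l) =
      winding (edgePath σ (i.succAbove j) (i.succAbove l)) :=
  winding_congr_fun fun t => congrArg σ (face_edge k i j l t)

theorem winding_edgePath_add {k : ℕ} (σ : Simplex Torus k) (i j l : Fin (k + 1)) :
    winding (edgePath σ i j) + winding (edgePath σ j l) = winding (edgePath σ i l) := by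
  rw [← winding_trans, winding_congr (edgePath_homotopic_trans σ i j l)]

/-- A 2-cochain on the torus whose coboundary evaluates `α` on chains, built from a primitive
`f` of `α` on the powers of `z` and a gauge function `g`. -/
def primitiveCochain (α : Γ → Γ → Γ → A) (z : Γ) (f : ℤ → ℤ → A) (g : Torus → Γ) :
    Chain Torus 2 →+ A :=
  Finsupp.liftAddHom fun σ => zmultiplesHom A
    (f (winding (edgePath σ 0 1) 1) (winding (edgePath σ 1 2) 1)
      + prism α (z ^ winding (edgePath σ 0 1) 1) (z ^ winding (edgePath σ 1 2) 1)
        (g (σ (stdSimplex.vertex 0))) (g (σ (stdSimplex.vertex 1)))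
        (g (σ (stdSimplex.vertex 2))))

theorem primitiveCochain_single (α : Γ → Γ → Γ → A) (z : Γ) (f : ℤ → ℤ → A) (g : Torus → Γ)
    (σ : Simplex Torus 2) :
    primitiveCochain α z f g (Finsupp.single σ 1) =
      f (winding (edgePath σ 0 1) 1) (winding (edgePath σ 1 2) 1)
      + prism α (z ^ winding (edgePath σ 0 1) 1) (z ^ winding (edgePath σ 1 2) 1)
        (g (σ (stdSimplex.vertex 0))) (g (σ (stdSimplex.vertex 1)))
        (g (σ (stdSimplex.vertex 2))) := by
  simp [primitiveCochain]

theorem primitiveCochain_face (α : Γ → Γ → Γ → A) (z : Γ) (f : ℤ → ℤ → A) (g : Torus → Γ)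
    (σ : Simplex Torus 3) (i : Fin 4) {j₀ j₁ j₂ : Fin 4} (h₀ : i.succAbove 0 = j₀)
    (h₁ : i.succAbove 1 = j₁) (h₂ : i.succAbove 2 = j₂) :
    primitiveCochain α z f g (Finsupp.single (σ.comp (face 2 i)) 1) =
      f (winding (edgePath σ j₀ j₁) 1) (winding (edgePath σ j₁ j₂) 1)
      + prism α (z ^ winding (edgePath σ j₀ j₁) 1) (z ^ winding (edgePath σ j₁ j₂) 1)
        (g (σ (stdSimplex.vertex j₀))) (g (σ (stdSimplex.vertex j₁)))
        (g (σ (stdSimplex.vertex j₂))) := by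
  subst h₀ h₁ h₂
  have hv (j : Fin 3) : (σ.comp (face 2 i)) (stdSimplex.vertex j) =
    σ (stdSimplex.vertex (i.succAbove j)) := congrArg σ (face_vertex 2 i j)
  rw [primitiveCochain_single, winding_edgePath_face, winding_edgePath_face, hv, hv, hv]

/-- On one simplex, `IsPhi.val_eq` puts the edge values in the form required by `IsCocycle.gauge`;
the displacements of edges `02` and `13` are sums along consecutive edges, so the `f` and prism
terms match those of the four faces. -/
theorem primitiveCochain_boundary {α : Γ → Γ → Γ → A} (hα : IsCocycle α) {z : Γ}
    {f : ℤ → ℤ → A} (hf : IsPrimitive α z f) {φ : Rep Torus Γ}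
    (hφ : IsPhi z (φ.restrict {basePoint})) (ζ : Chain Torus 3) :
    evalBar α (barChain φ 3 ζ) =
      primitiveCochain α z f (fun x => φ.val (basePath x)) (boundary Torus 2 ζ) := by
  suffices h : (evalBar α).comp (barChain φ 3) =
      (primitiveCochain α z f fun x => φ.val (basePath x)).comp (boundary Torus 2) from
    DFunLike.congr_fun h ζ
  refine Finsupp.addHom_ext' fun σ => AddMonoidHom.ext_int ?_
  simp only [AddMonoidHom.comp_apply, Finsupp.singleAddHom_apply]
  have hl : evalBar α (barChain φ 3 (Finsupp.single σ 1)) = α (φ.val (edgePath σ 0 1))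
      (φ.val (edgePath σ 1 2)) (φ.val (edgePath σ 2 3)) := by
    simp [evalBar, barChain]
  rw [hl, boundary_two_single, map_sub, map_add, map_sub,
    primitiveCochain_face α z f _ σ 0 (j₀ := 1) (j₁ := 2) (j₂ := 3) rfl rfl rfl,
    primitiveCochain_face α z f _ σ 1 (j₀ := 0) (j₁ := 2) (j₂ := 3) rfl rfl rfl,
    primitiveCochain_face α z f _ σ 2 (j₀ := 0) (j₁ := 1) (j₂ := 3) rfl rfl rfl,
    primitiveCochain_face α z f _ σ 3 (j₀ := 0) (j₁ := 1) (j₂ := 2) rfl rfl rfl,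
    hφ.val_eq (edgePath σ 0 1), hφ.val_eq (edgePath σ 1 2), hφ.val_eq (edgePath σ 2 3),
    hα.gauge, hf, ← winding_edgePath_add σ 0 1 2, ← winding_edgePath_add σ 1 2 3]
  simp only [Pi.add_apply, zpow_add]
  abel

theorem primitiveCochain_affineSimplex {α : Γ → Γ → Γ → A} (hα' : IsStronglyNormalized α)
    {z : Γ} {f : ℤ → ℤ → A} {g : Torus → Γ} (hg : g basePoint = 1)
    (P : Fin 3 → Fin 2 → ℤ) :
    primitiveCochain α z f g (Finsupp.single (affineSimplex P) 1) =
      f (P 1 1 - P 0 1) (P 2 1 - P 1 1) := by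
  rw [primitiveCochain_single]
  simp only [affineSimplex_vertex, hg, winding_edgePath_affineSimplex, prism, Pi.sub_apply]
  -- The gauge is `1` at every vertex, so each of the three prism terms has an argument `1`.
  rw [hα' _ _ 1 (by simp), hα' _ 1 _ (by simp), hα' 1 _ _ (by simp)]
  simp

theorem primitiveCochain_hat_sub {α : Γ → Γ → Γ → A} (hα' : IsStronglyNormalized α)
    {z : Γ} {f : ℤ → ℤ → A} (hf : IsPrimitive α z f) {g : Torus → Γ} (hg : g basePoint = 1)
    (a : Matrix.SpecialLinearGroup (Fin 2) ℤ) :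
    primitiveCochain α z f g (pushforward (hat a) 2 xiSt - xiSt) =
      f (a 1 0) (a 1 1) - f (a 1 1) (a 1 0) := by
  rw [pushforward_xiSt, xiSt_eq]
  simp only [map_sub, primitiveCochain_affineSimplex hα' hg]
  -- The contribution `f 0 1 - f 1 0` of `ξ^st` vanishes, both values being `f 0 0`.
  simp [hf.zero_left hα' 1, hf.zero_right hα' 1]

theorem evalBar_eq_epsilon {α : Γ → Γ → Γ → A} (hα : IsCocycle α)
    (hα' : IsStronglyNormalized α) {z : Γ} {φ : Rep Torus Γ}
    (hφ : IsPhi z (φ.restrict {basePoint})) (a : Matrix.SpecialLinearGroup (Fin 2) ℤ)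
    {ζ : Chain Torus 3} (hζ : boundary Torus 2 ζ = pushforward (hat a) 2 xiSt - xiSt) :
    evalBar α (barChain φ 3 ζ) = epsilon α z (a 1 0) (a 1 1) := by
  obtain ⟨f, hf⟩ := exists_isPrimitive hα hα' z
  rw [primitiveCochain_boundary hα hf hφ, hζ, primitiveCochain_hat_sub hα' hf
    φ.val_basePath_zero, hf.sub_swap_eq_epsilon]

theorem cycleCocycle_eq_epsilon {α : Γ → Γ → Γ → A} (hα : IsCocycle α)
    (hα' : IsStronglyNormalized α) {z : Γ} {φ : Rep Torus Γ}
    (hφ : IsPhi z (φ.restrict {basePoint})) (a : Matrix.SpecialLinearGroup (Fin 2) ℤ) :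
    cycleCocycle α φ (pushforward (hat a) 2 xiSt) xiSt = epsilon α z (a 1 0) (a 1 1) := by
  have h := exists_boundary_eq_hat_sub a
  rw [cycleCocycle, dif_pos h]
  exact evalBar_eq_epsilon hα hα' hφ a h.choose_spec

end Evaluation

end CycleCocycle

end

theorem mainTheorem3 {Γ : Type*} [Group Γ] {A : Type*} [AddCommGroup A]
    (α : Γ → Γ → Γ → A) (hα : CycleCocycle.IsCocycle α)
    (hα' : CycleCocycle.IsStronglyNormalized α)
    (z : Γ) (a : Matrix.SpecialLinearGroup (Fin 2) ℤ) :
    -- `ε(z; m, n)` is well defined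
    (∃ f : ℤ → ℤ → A, CycleCocycle.IsPrimitive α z f) ∧
    (∀ f : ℤ → ℤ → A, CycleCocycle.IsPrimitive α z f →
      ∀ m n : ℤ, f m n - f n m = CycleCocycle.epsilon α z m n) ∧
    -- `φ_z` is well defined, and extends to the whole fundamental groupoid
    (∃! φ₀ : CycleCocycle.Rep0 CycleCocycle.Torus {CycleCocycle.basePoint} Γ,
      CycleCocycle.IsPhi z φ₀) ∧
    (∃ φ : CycleCocycle.Rep CycleCocycle.Torus Γ,
      CycleCocycle.IsPhi z (φ.restrict {CycleCocycle.basePoint})) ∧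
    -- `â_# ξ^st` and `ξ^st` are homologous
    (∃ ζ : CycleCocycle.Chain CycleCocycle.Torus 3,
      CycleCocycle.boundary CycleCocycle.Torus 2 ζ =
        CycleCocycle.pushforward (CycleCocycle.hat a) 2 CycleCocycle.xiSt - CycleCocycle.xiSt) ∧
    -- for every functor that restricts to `φ_z`
    ∀ φ : CycleCocycle.Rep CycleCocycle.Torus Γ,
      CycleCocycle.IsPhi z (φ.restrict {CycleCocycle.basePoint}) →
      -- the value does not depend on the chain chosen
      (∀ ζ : CycleCocycle.Chain CycleCocycle.Torus 3,
        CycleCocycle.boundary CycleCocycle.Torus 2 ζ =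
          CycleCocycle.pushforward (CycleCocycle.hat a) 2 CycleCocycle.xiSt - CycleCocycle.xiSt →
        CycleCocycle.evalBar α (CycleCocycle.barChain φ 3 ζ) =
          CycleCocycle.cycleCocycle α φ
            (CycleCocycle.pushforward (CycleCocycle.hat a) 2 CycleCocycle.xiSt)
            CycleCocycle.xiSt) ∧
      -- it is `ε(z; c, d)`
      CycleCocycle.cycleCocycle α φ
          (CycleCocycle.pushforward (CycleCocycle.hat a) 2 CycleCocycle.xiSt)
          CycleCocycle.xiSt =
        CycleCocycle.epsilon α z (a 1 0) (a 1 1) ∧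
      -- it depends only on the bottom row
      ∀ a' : Matrix.SpecialLinearGroup (Fin 2) ℤ, a' 1 0 = a 1 0 → a' 1 1 = a 1 1 →
        CycleCocycle.cycleCocycle α φ
            (CycleCocycle.pushforward (CycleCocycle.hat a') 2 CycleCocycle.xiSt)
            CycleCocycle.xiSt =
          CycleCocycle.cycleCocycle α φ
            (CycleCocycle.pushforward (CycleCocycle.hat a) 2 CycleCocycle.xiSt)
            CycleCocycle.xiSt := by
  refine ⟨CycleCocycle.exists_isPrimitive hα hα' z, fun f hf => hf.sub_swap_eq_epsilon,
    ⟨_, CycleCocycle.windingRep_isPhi z, fun φ₀ h => h.unique (CycleCocycle.windingRep_isPhi z)⟩,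
    ⟨_, CycleCocycle.windingRep_isPhi z⟩, CycleCocycle.exists_boundary_eq_hat_sub a,
    fun φ hφ => ⟨fun ζ hζ => ?_, CycleCocycle.cycleCocycle_eq_epsilon hα hα' hφ a,
      fun a' hc hd => ?_⟩⟩
  · rw [CycleCocycle.evalBar_eq_epsilon hα hα' hφ a hζ,
      CycleCocycle.cycleCocycle_eq_epsilon hα hα' hφ a]
  · rw [CycleCocycle.cycleCocycle_eq_epsilon hα hα' hφ a',
      CycleCocycle.cycleCocycle_eq_epsilon hα hα' hφ a, hc, hd]
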